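/- Let $\mathbb Z/2$ act on $\mathbb R^{p,q}=(\mathbb R^{1,0})^{p-q}\oplus(\mathbb R^{1,1})^{q}$, where $\mathbb R^{1,0}$ and $\mathbb R^{1,1}$ are the trivial and the sign representation, and give the Grassmann manifold $G_n(\mathbb R^{p,q})$ of $n$-dimensional linear subspaces the induced action. Let $\sigma=(\sigma_1,\dots,\sigma_n)$ be a Schubert symbol, i.e. a sequence of integers with $1\le\sigma_1<\dots<\sigma_n\le p$, and let $\varphi=(\varphi_1,\dots,\varphi_q)$ be a flag symbol, i.e. a sequence of integers with $1\le\varphi_1<\dots<\varphi_q\le p$. Let $0=V_0\subset V_1\subset\dots\subset V_p=\mathbb R^{p,q}$ be a flag of subrepresentations determined by $\varphi$: each $V_i$ is obtained from $V_{i-1}$ by adjoining a coordinate basis vector, and $V_i/V_{i-1}$ is $\mathbb R^{1,1}$ if $i\in\{\varphi_1,\dots,\varphi_q\}$ and $\mathbb R^{1,0}$ otherwise. Let $$e(\sigma,\varphi)=\{\ell\in G_n(\mathbb R^{p,q}) : \dim(\ell\cap V_{\sigma_i})=1+\dim(\ell\cap V_{\sigma_i-1})\ \text{ for } i=1,\dots,n\}$$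 be the corresponding Schubert cell. Write $\varphi$ also for the set $\{\varphi_1,\dots,\varphi_q\}$, and put $\underline{\sigma_i}=\{1,\dots,\sigma_i\}$, $\sigma(i)=\{\sigma_1,\dots,\sigma_i\}$, and $$a=\sum_{i=1}^n(\sigma_i-i),\qquad b=\sum_{\sigma_i\in\varphi}\bigl|\underline{\sigma_i}\setminus(\varphi\cup\sigma(i))\bigr|+\sum_{\sigma_i\notin\varphi}\bigl|(\underline{\sigma_i}\cap\varphi)\setminus\sigma(i)\bigr| .$$ Then $e(\sigma,\varphi)$ is a representation cell of bidegree $(a,b)$. That is, $b\le a$, and there is a continuous $\mathbb Z/2$-equivariant map from the closed unit disk $D(\mathbb R^{a,b})$ to $G_n(\mathbb R^{p,q})$ that restricts to a homeomorphism from the interior of the disk onto $e(\sigma,\varphi)$ and maps the unit sphere $S(\mathbb R^{a,b})$ into the union of the Schubert cells $e(\tau,\varphi)$ (for the same flag) with $\sum_{i=1}^n(\tau_i-i)<a$. -/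

import Mathlib

namespace RepGrassmann

/-- The underlying Euclidean space `ℝ^p` of the representation `ℝ^{p,q}`. -/
abbrev E (p : ℕ) : Type := EuclideanSpace ℝ (Fin p)

/-- The sign by which the generator of `ℤ/2` acts on the `k`-th coordinate (counted from `0`) of
`ℝ^{p,q} = (ℝ^{1,0})^{p-q} ⊕ (ℝ^{1,1})^q`, for `q ≤ p`: the first `p - q` coordinates are fixed,
the last `q` coordinates are negated. -/
def sgn (p q : ℕ) (k : Fin p) : ℝ := if (k : ℕ) + q < p then 1 else -1

theorem sgn_mul_self (p q : ℕ) (k : Fin p) : sgn p q k * sgn p q k = 1 := by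
  unfold sgn
  split <;> norm_num

/-- The action of the generator of `ℤ/2` on `ℝ^{p,q}`; it is a linear involution. -/
def act (p q : ℕ) : E p ≃ₗ[ℝ] E p where
  toFun x := WithLp.toLp 2 fun k => sgn p q k * x k
  invFun x := WithLp.toLp 2 fun k => sgn p q k * x k
  map_add' x y := by
    ext k
    simp [mul_add]
  map_smul' c x := by
    ext k
    simp [mul_left_comm]
  left_inv x := by
    ext k
    simp [← mul_assoc, sgn_mul_self]
  right_inv x := by
    ext k
    simp [← mul_assoc, sgn_mul_self]

/-- The set `G_n(ℝ^p)` of `n`-dimensional linear subspaces of `ℝ^p`. -/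
def Grassmannian (n p : ℕ) : Type :=
  {l : Submodule ℝ (E p) // Module.finrank ℝ l = n}

/-- The `n`-frames in `ℝ^p` (linearly independent `n`-tuples), topologized as a subspace of
`(ℝ^p)^n`. -/
abbrev Frame (n p : ℕ) : Type := {v : Fin n → E p // LinearIndependent ℝ v}

/-- The subspace spanned by a frame. -/
def Frame.toGrassmannian {n p : ℕ} (v : Frame n p) : Grassmannian n p :=
  ⟨Submodule.span ℝ (Set.range v.1), by simpa using finrank_span_eq_card v.2⟩

/-- The usual topology of the Grassmann manifold: the quotient topology from the space of
frames. -/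
instance (n p : ℕ) : TopologicalSpace (Grassmannian n p) :=
  TopologicalSpace.coinduced (Frame.toGrassmannian (n := n) (p := p)) inferInstance

/-- The induced action of the generator of `ℤ/2` on `G_n(ℝ^{p,q})`. -/
def Grassmannian.act {n p : ℕ} (q : ℕ) (l : Grassmannian n p) : Grassmannian n p :=
  ⟨l.1.map (RepGrassmann.act p q).toLinearMap, by
    rw [LinearEquiv.finrank_map_eq]
    exact l.2⟩

/-- A flag symbol `1 ≤ φ_1 < ⋯ < φ_q ≤ p` for `ℝ^{p,q}`. -/
structure FlagSymbol (p q : ℕ) where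
  seq : Fin q → ℕ
  strictMono : StrictMono seq
  one_le : ∀ i, 1 ≤ seq i
  le : ∀ i, seq i ≤ p

/-- The set of the entries of a flag symbol. -/
def FlagSymbol.entries {p q : ℕ} (φ : FlagSymbol p q) : Finset ℕ :=
  Finset.univ.image φ.seq

/-- A Schubert symbol `1 ≤ σ_1 < ⋯ < σ_n ≤ p`; the entry `σ_{i+1}` is `seq i`. -/
structure SchubertSymbol (n p : ℕ) where
  seq : Fin n → ℕ
  strictMono : StrictMono seq
  one_le : ∀ i, 1 ≤ seq i
  le : ∀ i, seq i ≤ p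

/-- `V_0 ⊂ V_1 ⊂ ⋯ ⊂ V_p` is a flag of subrepresentations of `ℝ^{p,q}` of the kind determined by
the flag symbol `φ`: each `V_i` arises from `V_{i-1}` by adjoining a coordinate basis vector, and
the one-dimensional representation `V_i / V_{i-1}` is `ℝ^{1,1}` (the generator of `ℤ/2` acts on it
as `-1`) if `i` is an entry of `φ` and `ℝ^{1,0}` (the generator acts as the identity) otherwise.
Only the values `V i` with `i ≤ p` matter. -/
structure IsFlag {p q : ℕ} (φ : FlagSymbol p q) (V : ℕ → Submodule ℝ (E p)) : Prop where
  zero : V 0 = ⊥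
  top : V p = ⊤
  adjoin : ∀ i, 1 ≤ i → i ≤ p → ∃ k : Fin p, EuclideanSpace.single k (1 : ℝ) ∉ V (i - 1) ∧
    V i = V (i - 1) ⊔ Submodule.span ℝ {EuclideanSpace.single k (1 : ℝ)}
  invariant : ∀ i, i ≤ p → ∀ v ∈ V i, act p q v ∈ V i
  twisted : ∀ i, 1 ≤ i → i ≤ p → i ∈ φ.entries → ∀ v ∈ V i, act p q v - (-v) ∈ V (i - 1)
  untwisted : ∀ i, 1 ≤ i → i ≤ p → i ∉ φ.entries → ∀ v ∈ V i, act p q v - v ∈ V (i - 1)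

namespace SchubertSymbol

variable {n p : ℕ}

/-- The Schubert cell `e(σ, V)` of a flag `V`: the subspaces `l` with
`dim (l ∩ V_{σ_i}) = 1 + dim (l ∩ V_{σ_i - 1})` for all `i`. -/
def cell (σ : SchubertSymbol n p) (V : ℕ → Submodule ℝ (E p)) : Set (Grassmannian n p) :=
  {l | ∀ i, Module.finrank ℝ (l.1 ⊓ V (σ.seq i) : Submodule ℝ (E p)) =
    1 + Module.finrank ℝ (l.1 ⊓ V (σ.seq i - 1) : Submodule ℝ (E p))}

/-- `∑ (σ_i - i)`. No subtraction truncates, since `i ≤ σ_i`. -/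
def dim (σ : SchubertSymbol n p) : ℕ := ∑ i, (σ.seq i - ((i : ℕ) + 1))

/-- `{σ_1, …, σ_i}`. -/
def initial (σ : SchubertSymbol n p) (i : Fin n) : Finset ℕ := (Finset.Iic i).image σ.seq

/-- The number of twists
`∑_{σ_i ∈ φ} |{1,…,σ_i} \ (φ ∪ {σ_1,…,σ_i})| + ∑_{σ_i ∉ φ} |({1,…,σ_i} ∩ φ) \ {σ_1,…,σ_i}|`. -/
def twists {q : ℕ} (σ : SchubertSymbol n p) (φ : FlagSymbol p q) : ℕ :=
  ∑ i with σ.seq i ∈ φ.entries,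
      (Finset.Icc 1 (σ.seq i) \ (φ.entries ∪ σ.initial i)).card +
    ∑ i with σ.seq i ∉ φ.entries,
      ((Finset.Icc 1 (σ.seq i) ∩ φ.entries) \ σ.initial i).card

end SchubertSymbol

/-- The union of the Schubert cells (for the flag `V`) of dimension less than `d`. -/
def skeletonBelow {p : ℕ} (n : ℕ) (V : ℕ → Submodule ℝ (E p)) (d : ℕ) :
    Set (Grassmannian n p) :=
  {l | ∃ τ : SchubertSymbol n p, τ.dim < d ∧ l ∈ τ.cell V}

/-- Let `X` be a space with an involution `g`. The subset `e` of `X` is a representation cell of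
bidegree `(a, b)` attached to the subset `A`: there is a continuous equivariant map `Φ` from the
unit disk `D(ℝ^{a,b})` to `X` which restricts to a homeomorphism from the interior of the disk onto
`e` and maps the unit sphere `S(ℝ^{a,b})` into `A`. -/
def IsRepCell {X : Type*} [TopologicalSpace X] (g : X → X) (A e : Set X) (a b : ℕ) : Prop :=
  b ≤ a ∧ ∃ Φ : E a → X,
    ContinuousOn Φ (Metric.closedBall 0 1) ∧
    (∀ x ∈ Metric.closedBall (0 : E a) 1, Φ (act a b x) = g (Φ x)) ∧
    Topology.IsEmbedding ((Metric.ball (0 : E a) 1).domRestrict Φ) ∧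
    Φ '' Metric.ball 0 1 = e ∧
    Set.MapsTo Φ (Metric.sphere 0 1) A

end RepGrassmann

/-! The flag is the coordinate filtration of a reordered standard basis `b`, on which the generator
g acts by signs (`IsFlag.exists_orthonormalBasis`). A plane lies in the cell of σ exactly when the
last nonzero coordinates of its nonzero vectors occur at the positions σ_i (`mem_cell_iff`).

The characteristic map is built from reflections. Let e_i be the basis vector at position σ_i, and
let t_i be a combination of the basis vectors before e_i other than e_k for k < i; this leaves σ_i -
i parameters. Let R be the product of the reflections negating e_i + t_i, the last one acting first,
and put x_i = R e_i. The reflections with index above i fix e_i, and those with index below i are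
the identity modulo V_{σ_i - 1}. So x_i lies in V_{σ_i}, and its e_i-coordinate is 1 - 2/(1 +
‖t_i‖²), negative for ‖t_i‖ < 1 and zero for ‖t_i‖ = 1: each factor is a stereographic projection of
a ball onto a hemisphere. Hence the interior of the product of unit balls maps bijectively onto the
cell (`echelonFrame_injective`, `exists_echelonFrame_mem`), and its boundary maps into lower cells
(`exists_dim_lt`).

Replacing each t_i by ± g t_i, with the sign of e_i, conjugates R by g and so moves the plane by g.
The coordinate of t_i along a basis vector is thereby multiplied by the product of two signs, which
gives the twist count. A radial rescaling that commutes with the action turns the product of balls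
into the round disk, and compactness together with the Hausdorff property turns the bijection into
an embedding. -/

namespace RepGrassmann

open Module

/-- The filtration of an inner product space by the spans of the first vectors of an orthonormal
basis: the vectors whose coordinates of index at least `m` vanish. -/
def coordFiltration {p : ℕ} {F : Type*} [NormedAddCommGroup F] [InnerProductSpace ℝ F]
    (b : OrthonormalBasis (Fin p) ℝ F) (m : ℕ) : Submodule ℝ F where
  carrier := {x | ∀ j : Fin p, m ≤ j → inner ℝ (b j) x = 0}
  add_mem' hx hy j hj := by rw [inner_add_right, hx j hj, hy j hj, add_zero]
  zero_mem' j _ := inner_zero_right _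
  smul_mem' c x hx j hj := by rw [inner_smul_right, hx j hj, mul_zero]

/-! ### Flags of subrepresentations as coordinate filtrations. -/

section Flag

variable {p q : ℕ} {φ : FlagSymbol p q} {V : ℕ → Submodule ℝ (E p)}

theorem IsFlag.mem_iff_of_adjoin (hV : IsFlag φ V) {k : Fin p → Fin p}
    (hk : ∀ i : Fin p, V (i + 1) = V i ⊔ Submodule.span ℝ {EuclideanSpace.single (k i) (1 : ℝ)})
    (i : ℕ) (hi : i ≤ p) (x : E p) :
    x ∈ V i ↔ ∀ c, (∀ j : Fin p, (j : ℕ) < i → k j ≠ c) → x c = 0 := by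
  induction i generalizing x with
  | zero =>
    rw [hV.zero, Submodule.mem_bot]
    constructor
    · rintro rfl c -
      rfl
    · intro h
      ext c
      exact h c (by simp)
  | succ i ih =>
    have hki := hk ⟨i, hi⟩
    simp only at hki
    rw [hki, Submodule.mem_sup]
    constructor
    · rintro ⟨y, hy, z, hz, rfl⟩ c hc
      obtain ⟨a, rfl⟩ := Submodule.mem_span_singleton.1 hz
      have h1 := (ih (by omega) y).1 hy c fun j hj => hc j (by omega)
      have h2 : k ⟨i, hi⟩ ≠ c := hc ⟨i, hi⟩ (by simp)
      simp [h1, h2.symm]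
    · intro h
      refine ⟨x - x (k ⟨i, hi⟩) • EuclideanSpace.single (k ⟨i, hi⟩) (1 : ℝ), ?_, _,
        Submodule.mem_span_singleton.2 ⟨x (k ⟨i, hi⟩), rfl⟩, sub_add_cancel _ _⟩
      rw [ih (by omega)]
      intro c hc
      by_cases hck : c = k ⟨i, hi⟩
      · subst hck
        simp
      · have : x c = 0 := by
          refine h c fun j hj => ?_
          rcases Nat.lt_succ_iff_lt_or_eq.1 hj with h' | h'
          · exact hc j h'
          · rintro rfl
            exact hck (congrArg k (Fin.ext h'))
        simp [this, hck]

/-- A flag of subrepresentations is the coordinate filtration of a reordering of the standard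
basis, and the generator acts on the basis vectors by the signs that the flag symbol prescribes. -/
theorem IsFlag.exists_orthonormalBasis (hV : IsFlag φ V) :
    ∃ b : OrthonormalBasis (Fin p) ℝ (E p), (∀ i ≤ p, V i = coordFiltration b i) ∧
      ∀ j : Fin p, act p q (b j) = (if (j : ℕ) + 1 ∈ φ.entries then (-1 : ℝ) else 1) • b j := by
  choose k hk1 hk2 using fun i : Fin p => hV.adjoin (i + 1) (by omega) (by omega)
  simp only [Nat.add_sub_cancel] at hk1 hk2
  have hmem := hV.mem_iff_of_adjoin hk2
  have hlt : ∀ i j : Fin p, j < i → k j ≠ k i := by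
    intro i j hji hkk
    refine hk1 i ((hmem i i.2.le _).2 fun c hc => ?_)
    have : c ≠ k i := fun h => hc j hji (hkk.trans h.symm)
    simp [this]
  have hinj : Function.Injective k := by
    intro i j h
    by_contra hne
    rcases lt_or_gt_of_ne hne with h' | h'
    · exact hlt _ _ h' h
    · exact hlt _ _ h' h.symm
  let κ : Fin p ≃ Fin p := Equiv.ofBijective k (Finite.injective_iff_bijective.1 hinj)
  have hb : ∀ j, ((EuclideanSpace.basisFun (Fin p) ℝ).reindex κ.symm) j =
      EuclideanSpace.single (k j) (1 : ℝ) := by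
    intro j
    simp [κ]
  refine ⟨(EuclideanSpace.basisFun (Fin p) ℝ).reindex κ.symm, ?_, ?_⟩
  · intro i hi
    ext x
    rw [hmem i hi]
    change _ ↔ ∀ j : Fin p, i ≤ j → inner ℝ _ x = 0
    simp only [hb, EuclideanSpace.inner_single_left, map_one, one_mul]
    constructor
    · intro h j hj
      exact h _ fun j' hj' hkk => by
        have := hinj hkk
        subst this
        omega
    · intro h c hc
      obtain ⟨j, rfl⟩ := κ.surjective c
      exact h j (not_lt.1 fun hj => hc j hj rfl)
  · intro j
    rw [hb]
    have hact : act p q (EuclideanSpace.single (k j) (1 : ℝ)) =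
        sgn p q (k j) • EuclideanSpace.single (k j) (1 : ℝ) := by
      ext c
      by_cases hc : c = k j
      · subst hc
        simp [act]
      · simp [act, hc]
    rw [hact]
    have hmemb : EuclideanSpace.single (k j) (1 : ℝ) ∈ V (j + 1) := by
      rw [hk2]
      exact Submodule.mem_sup_right (Submodule.mem_span_singleton_self _)
    congr 1
    split_ifs with hφ
    · have h := hV.twisted (j + 1) (by omega) (by omega) hφ _ hmemb
      rw [hact, Nat.add_sub_cancel, sub_neg_eq_add] at h
      nth_rw 2 [← one_smul ℝ (EuclideanSpace.single (k j) (1 : ℝ))] at h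
      rw [← add_smul] at h
      -- Here (sign + 1) times the new basis vector lies in V_j while the vector does not, so the
      -- scalar must vanish.
      by_contra hne
      exact hk1 j ((Submodule.smul_mem_iff _ fun h0 => hne (eq_neg_of_add_eq_zero_left h0)).1 h)
    · have h := hV.untwisted (j + 1) (by omega) (by omega) hφ _ hmemb
      rw [hact, Nat.add_sub_cancel] at h
      nth_rw 2 [← one_smul ℝ (EuclideanSpace.single (k j) (1 : ℝ))] at h
      rw [← sub_smul] at h
      by_contra hne
      exact hk1 j ((Submodule.smul_mem_iff _ fun h0 => hne (sub_eq_zero.1 h0)).1 h)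

end Flag

/-! ### Jumps of a subspace along the filtration. -/

section Filtration

variable {p : ℕ} {F : Type*} [NormedAddCommGroup F] [InnerProductSpace ℝ F]
  (b : OrthonormalBasis (Fin p) ℝ F)

theorem coordFiltration_mono : Monotone (coordFiltration b) :=
  fun _ _ h _ hx j hj => hx j (h.trans hj)

theorem coordFiltration_zero : coordFiltration b 0 = ⊥ := by
  refine (Submodule.eq_bot_iff _).2 fun x hx => ?_
  rw [← b.sum_repr' x]
  exact Finset.sum_eq_zero fun j _ => by rw [hx j (Nat.zero_le _), zero_smul]

theorem coordFiltration_eq_top {m : ℕ} (hm : p ≤ m) : coordFiltration b m = ⊤ :=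
  eq_top_iff.2 fun _ _ j hj => absurd (hm.trans hj) (not_le.2 j.2)

theorem basis_mem_coordFiltration {j : Fin p} {m : ℕ} (h : (j : ℕ) < m) :
    b j ∈ coordFiltration b m := by
  intro i hi
  exact b.orthonormal.2 (by rintro rfl; omega)

theorem mem_coordFiltration_of_succ {j : Fin p} {x : F} (hx : x ∈ coordFiltration b (j + 1))
    (h0 : inner ℝ (b j) x = 0) : x ∈ coordFiltration b j := by
  intro i hi
  rcases eq_or_lt_of_le hi with h | h
  · rwa [← Fin.ext h]
  · exact hx i h

/-- The indices of the last nonzero coordinates of the nonzero vectors of a subspace. -/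
def jumps (l : Submodule ℝ F) : Set (Fin p) :=
  {j | ∃ x ∈ l, x ∈ coordFiltration b (j + 1) ∧ inner ℝ (b j) x ≠ 0}

/-- The `j`-th coordinate is a linear functional on the larger intersection whose kernel lies in the
smaller one. -/
theorem finrank_inf_coordFiltration_succ_le [FiniteDimensional ℝ F] (l : Submodule ℝ F)
    (j : Fin p) :
    finrank ℝ (l ⊓ coordFiltration b (j + 1) : Submodule ℝ F) ≤
      finrank ℝ (l ⊓ coordFiltration b j : Submodule ℝ F) + 1 := by
  let f : (l ⊓ coordFiltration b (j + 1) : Submodule ℝ F) →ₗ[ℝ] ℝ :=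
    (innerₗ F (b j)).comp (Submodule.subtype _)
  have h1 := f.finrank_range_add_finrank_ker
  have h2 : finrank ℝ (LinearMap.range f) ≤ 1 := by
    simpa using Submodule.finrank_le (LinearMap.range f)
  have h3 : finrank ℝ (LinearMap.ker f) ≤
      finrank ℝ (l ⊓ coordFiltration b j : Submodule ℝ F) := by
    rw [← Submodule.finrank_map_subtype_eq]
    refine Submodule.finrank_mono ?_
    rintro _ ⟨x, hx, rfl⟩
    exact ⟨x.2.1, mem_coordFiltration_of_succ b x.2.2 hx⟩
  omega

theorem finrank_inf_coordFiltration_succ_iff [FiniteDimensional ℝ F] (l : Submodule ℝ F)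
    (j : Fin p) :
    finrank ℝ (l ⊓ coordFiltration b (j + 1) : Submodule ℝ F) =
      1 + finrank ℝ (l ⊓ coordFiltration b j : Submodule ℝ F) ↔ j ∈ jumps b l := by
  have hle : l ⊓ coordFiltration b j ≤ l ⊓ coordFiltration b (j + 1) :=
    inf_le_inf_left _ (coordFiltration_mono b (Nat.le_succ _))
  constructor
  · intro h
    by_contra hj
    have : l ⊓ coordFiltration b (j + 1) ≤ l ⊓ coordFiltration b j := by
      rintro x ⟨hx, hx'⟩
      refine ⟨hx, mem_coordFiltration_of_succ b hx' ?_⟩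
      by_contra h0
      exact hj ⟨x, hx, hx', h0⟩
    rw [le_antisymm this hle] at h
    omega
  · rintro ⟨x, hx, hx', h0⟩
    have hlt : l ⊓ coordFiltration b j < l ⊓ coordFiltration b (j + 1) :=
      lt_of_le_of_ne hle fun h => h0 ((h.ge ⟨hx, hx'⟩ : x ∈ l ⊓ coordFiltration b j).2 j le_rfl)
    have := Submodule.finrank_lt_finrank_of_lt hlt
    have := finrank_inf_coordFiltration_succ_le b l j
    omega

open Classical in
theorem card_jumps_lt [FiniteDimensional ℝ F] (l : Submodule ℝ F) (m : ℕ) (hm : m ≤ p) :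
    (Finset.univ.filter fun j : Fin p => j ∈ jumps b l ∧ (j : ℕ) < m).card =
      finrank ℝ (l ⊓ coordFiltration b m : Submodule ℝ F) := by
  induction m with
  | zero =>
    rw [coordFiltration_zero, inf_bot_eq]
    simp
  | succ m ih =>
    have ih := ih (by omega)
    have hle : finrank ℝ (l ⊓ coordFiltration b m : Submodule ℝ F) ≤
        finrank ℝ (l ⊓ coordFiltration b (m + 1) : Submodule ℝ F) :=
      Submodule.finrank_mono (inf_le_inf_left _ (coordFiltration_mono b (Nat.le_succ _)))
    have h1 := finrank_inf_coordFiltration_succ_le b l ⟨m, hm⟩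
    have h2 := finrank_inf_coordFiltration_succ_iff b l ⟨m, hm⟩
    simp only at h1 h2
    by_cases hj : (⟨m, hm⟩ : Fin p) ∈ jumps b l
    · have : (Finset.univ.filter fun j : Fin p => j ∈ jumps b l ∧ (j : ℕ) < m + 1) =
          insert ⟨m, hm⟩ (Finset.univ.filter fun j : Fin p => j ∈ jumps b l ∧ (j : ℕ) < m) := by
        ext j
        simp only [Finset.mem_filter, Finset.mem_univ, true_and, Finset.mem_insert]
        constructor
        · rintro ⟨h, h'⟩
          by_cases hjm : (j : ℕ) = m
          · exact Or.inl (Fin.ext hjm)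
          · exact Or.inr ⟨h, by omega⟩
        · rintro (rfl | ⟨h, h'⟩)
          · exact ⟨hj, Nat.lt_succ_self m⟩
          · exact ⟨h, by omega⟩
      rw [this, Finset.card_insert_of_notMem (by simp), ih, h2.2 hj, add_comm]
    · have : (Finset.univ.filter fun j : Fin p => j ∈ jumps b l ∧ (j : ℕ) < m + 1) =
          (Finset.univ.filter fun j : Fin p => j ∈ jumps b l ∧ (j : ℕ) < m) := by
        ext j
        simp only [Finset.mem_filter, Finset.mem_univ, true_and]
        refine and_congr_right fun h => ⟨fun h' => ?_, fun h' => by omega⟩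
        refine lt_of_le_of_ne (Nat.lt_succ_iff.1 h') fun hjm => hj ?_
        rwa [← Fin.ext (a := j) (b := ⟨m, hm⟩) hjm]
      rw [this, ih]
      have := mt h2.1 hj
      omega

-- An `n`-dimensional subspace thus has exactly `n` jumps, so they determine its Schubert symbol.
open Classical in
theorem card_jumps [FiniteDimensional ℝ F] (l : Submodule ℝ F) :
    (jumps b l).toFinset.card = finrank ℝ l := by
  have h := card_jumps_lt b l p le_rfl
  rw [coordFiltration_eq_top b le_rfl, inf_top_eq] at h
  rw [← h]
  congr 1
  ext j
  simp

end Filtration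

/-! ### Products of reflections and stereographic projection. -/

section Reflections

variable {F : Type*} [NormedAddCommGroup F] [InnerProductSpace ℝ F]

/-- The orthogonal reflection that negates `u`. -/
noncomputable def hyperplaneReflection (u : F) : F ≃ₗᵢ[ℝ] F :=
  (Submodule.span ℝ {u})ᗮ.reflection

theorem hyperplaneReflection_apply (u x : F) :
    hyperplaneReflection u x = x - (2 * (inner ℝ u x / ‖u‖ ^ 2)) • u := by
  rw [hyperplaneReflection, Submodule.reflection_orthogonal_apply,
    Submodule.reflection_singleton_apply, two_smul, mul_smul, two_smul]
  simp

theorem hyperplaneReflection_of_inner_eq_zero {u x : F} (h : inner ℝ u x = 0) :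
    hyperplaneReflection u x = x := by
  simp [hyperplaneReflection_apply, h]

theorem hyperplaneReflection_sub_mem {W : Submodule ℝ F} {u : F} (hu : u ∈ W) (x : F) :
    hyperplaneReflection u x - x ∈ W := by
  rw [hyperplaneReflection_apply, sub_sub_cancel_left]
  exact W.neg_mem (W.smul_mem _ hu)

/-- The composite of the reflections that negate `u 0, …, u (n - 1)`; the last one acts first. -/
noncomputable def reflectionProd : {n : ℕ} → (Fin n → F) → (F ≃ₗᵢ[ℝ] F)
  | 0, _ => LinearIsometryEquiv.refl ℝ F
  | n + 1, u => (hyperplaneReflection (u (Fin.last n))).trans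
      (reflectionProd fun i : Fin n => u i.castSucc)

theorem reflectionProd_succ {n : ℕ} (u : Fin (n + 1) → F) (x : F) :
    reflectionProd u x = reflectionProd (fun i : Fin n => u i.castSucc)
      (hyperplaneReflection (u (Fin.last n)) x) := rfl

/-- Reflecting along a vector of `W` changes nothing modulo `W`. Taking for `W` a step of the flag,
this controls the leading coordinates of the frame. -/
theorem reflectionProd_sub_mem {W : Submodule ℝ F} {n : ℕ} {u : Fin n → F} (hu : ∀ i, u i ∈ W)
    (x : F) : reflectionProd u x - x ∈ W := by
  induction n generalizing x with
  | zero => simp [reflectionProd]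
  | succ n ih =>
    rw [reflectionProd_succ, ← sub_add_sub_cancel]
    exact W.add_mem (ih (fun i => hu _) _) (hyperplaneReflection_sub_mem (hu _) x)

theorem reflectionProd_mem_iff {W : Submodule ℝ F} {n : ℕ} {u : Fin n → F} (hu : ∀ i, u i ∈ W)
    {x : F} : reflectionProd u x ∈ W ↔ x ∈ W := by
  have h := reflectionProd_sub_mem hu x
  constructor
  · intro hx
    simpa using W.sub_mem hx h
  · intro hx
    simpa using W.add_mem h hx

theorem continuous_reflectionProd {X : Type*} [TopologicalSpace X] {n : ℕ} {u : X → Fin n → F}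
    {z : X → F} (hu : Continuous u) (h0 : ∀ x i, u x i ≠ 0) (hz : Continuous z) :
    Continuous fun x => reflectionProd (u x) (z x) := by
  induction n generalizing z with
  | zero => exact hz
  | succ n ih =>
    simp only [reflectionProd_succ]
    refine ih (by fun_prop) (fun x i => h0 x _) ?_
    simp only [hyperplaneReflection_apply]
    have h1 : Continuous fun x => u x (Fin.last n) := by fun_prop
    refine hz.sub (Continuous.smul (continuous_const.mul ?_) h1)
    exact (h1.inner hz).div (h1.norm.pow 2) fun x => by simpa using h0 x _

/-- A reflection depends only on the line of its vector, so the sign `c` is harmless; this is the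
source of equivariance. -/
theorem hyperplaneReflection_map (g : F →ₗᵢ[ℝ] F) {c : ℝ} (hc : c * c = 1) (u x : F) :
    hyperplaneReflection (c • g u) (g x) = g (hyperplaneReflection u x) := by
  have hn : ‖c • g u‖ ^ 2 = ‖u‖ ^ 2 := by
    rw [norm_smul, g.norm_map, mul_pow, Real.norm_eq_abs, sq_abs, sq, hc, one_mul]
  rw [hyperplaneReflection_apply, hyperplaneReflection_apply, map_sub, map_smul, hn,
    inner_smul_left, g.inner_map_map, smul_smul]
  congr 2
  simp only [conj_trivial]
  linear_combination (2 * (inner ℝ u x / ‖u‖ ^ 2)) * hc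

theorem reflectionProd_map (g : F →ₗᵢ[ℝ] F) {n : ℕ} {c : Fin n → ℝ} (hc : ∀ i, c i * c i = 1)
    (u : Fin n → F) (x : F) :
    reflectionProd (fun i => c i • g (u i)) (g x) = g (reflectionProd u x) := by
  induction n generalizing x with
  | zero => rfl
  | succ n ih =>
    rw [reflectionProd_succ, reflectionProd_succ, hyperplaneReflection_map g (hc _),
      ih fun i => hc _]

section Stereographic

variable {e t : F}

theorem norm_add_sq_of_unit (he : ‖e‖ = 1) (ht : inner ℝ e t = 0) :
    ‖e + t‖ ^ 2 = 1 + ‖t‖ ^ 2 := by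
  rw [norm_add_sq_real, he, ht]
  ring

theorem hyperplaneReflection_unit (he : ‖e‖ = 1) (ht : inner ℝ e t = 0) :
    hyperplaneReflection (e + t) e = e - (2 / (1 + ‖t‖ ^ 2)) • (e + t) := by
  rw [hyperplaneReflection_apply, norm_add_sq_of_unit he ht, inner_add_left,
    real_inner_self_eq_norm_sq, he, real_inner_comm, ht]
  congr 2
  ring

theorem inner_hyperplaneReflection_unit (he : ‖e‖ = 1) (ht : inner ℝ e t = 0) :
    inner ℝ e (hyperplaneReflection (e + t) e) = 1 - 2 / (1 + ‖t‖ ^ 2) := by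
  rw [hyperplaneReflection_unit he ht, inner_sub_right, inner_smul_right, inner_add_right, ht,
    real_inner_self_eq_norm_sq, he]
  ring

theorem inner_hyperplaneReflection_unit_neg_iff (he : ‖e‖ = 1) (ht : inner ℝ e t = 0) :
    inner ℝ e (hyperplaneReflection (e + t) e) < 0 ↔ ‖t‖ < 1 := by
  have h : 0 < 1 + ‖t‖ ^ 2 := by positivity
  rw [inner_hyperplaneReflection_unit he ht, sub_neg, lt_div_iff₀ h,
    ← sq_lt_one_iff₀ (norm_nonneg t)]
  constructor <;> intro h <;> linarith

theorem hyperplaneReflection_unit_injective {t' : F} (he : ‖e‖ = 1) (ht : inner ℝ e t = 0)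
    (ht' : inner ℝ e t' = 0)
    (h : hyperplaneReflection (e + t) e = hyperplaneReflection (e + t') e) : t = t' := by
  have h1 := congrArg (inner ℝ e) h
  rw [inner_hyperplaneReflection_unit he ht, inner_hyperplaneReflection_unit he ht',
    sub_right_inj] at h1
  rw [hyperplaneReflection_unit he ht, hyperplaneReflection_unit he ht', h1, sub_right_inj] at h
  have h2 : (2 / (1 + ‖t'‖ ^ 2) : ℝ) ≠ 0 := by positivity
  exact add_left_cancel (smul_right_injective F h2 h)

/-- A unit vector `y` with `⟪e, y⟫ < 0` is the mirror image of `e` in the hyperplane orthogonal to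
`e + t`, where `t` is a combination of `e` and `y`, orthogonal to `e`, of norm less than one. -/
theorem exists_hyperplaneReflection_unit_eq {y : F} (he : ‖e‖ = 1) (hy : ‖y‖ = 1)
    (hey : inner ℝ e y < 0) : ∃ t : F, inner ℝ e t = 0 ∧ ‖t‖ < 1 ∧
      hyperplaneReflection (e + t) e = y ∧ ∃ c d : ℝ, t = c • e + d • y := by
  set α : ℝ := inner ℝ e y with hα
  have hk : (1 - α)⁻¹ ≠ 0 := inv_ne_zero (by linarith)
  -- The reflection exchanging `e` and `y` negates `e - y`; the factor (1 - α)⁻¹ makes its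
  -- `e`-coordinate equal to 1.
  have hadd : e + ((1 - α)⁻¹ • (e - y) - e) = (1 - α)⁻¹ • (e - y) := add_sub_cancel _ _
  have ht : inner ℝ e ((1 - α)⁻¹ • (e - y) - e) = 0 := by
    rw [inner_sub_right, inner_smul_right, inner_sub_right, real_inner_self_eq_norm_sq, he, ← hα,
      one_pow, inv_mul_cancel₀ (by linarith), sub_self]
  have hrefl : hyperplaneReflection (e + ((1 - α)⁻¹ • (e - y) - e)) e = y := by
    rw [hadd, hyperplaneReflection]
    have hs : Submodule.span ℝ {(1 - α)⁻¹ • (e - y)} = Submodule.span ℝ {e - y} :=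
      Submodule.span_singleton_smul_eq (IsUnit.mk0 _ hk) _
    have := Submodule.reflection_sub (v := e) (w := y) (he.trans hy.symm)
    simp only [hs]
    exact this
  refine ⟨(1 - α)⁻¹ • (e - y) - e, ht, ?_, hrefl, (1 - α)⁻¹ - 1, -(1 - α)⁻¹, by module⟩
  rw [← inner_hyperplaneReflection_unit_neg_iff he ht, hrefl]
  exact hey

end Stereographic

end Reflections

/-! ### Orthonormal frames in echelon form. -/

section EchelonFrame

variable {p : ℕ} {F : Type*} [NormedAddCommGroup F] [InnerProductSpace ℝ F]
  (b : OrthonormalBasis (Fin p) ℝ F)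

/-- `t i` is a combination of the basis vectors `b j` with `j < s i` and `j ≠ s 0, …, s (i - 1)`. -/
def IsEchelon {n : ℕ} (s : Fin n → Fin p) (t : Fin n → F) : Prop :=
  ∀ i, t i ∈ coordFiltration b (s i) ∧ ∀ j < i, inner ℝ (b (s j)) (t i) = 0

variable {b}

theorem IsEchelon.castSucc {n : ℕ} {s : Fin (n + 1) → Fin p} {t : Fin (n + 1) → F}
    (h : IsEchelon b s t) :
    IsEchelon b (fun i : Fin n => s i.castSucc) (fun i : Fin n => t i.castSucc) :=
  fun _ => ⟨(h _).1, fun _ hj => (h _).2 _ (Fin.castSucc_lt_castSucc_iff.2 hj)⟩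

theorem IsEchelon.inner_self {n : ℕ} {s : Fin n → Fin p} {t : Fin n → F} (h : IsEchelon b s t)
    (i : Fin n) : inner ℝ (b (s i)) (t i) = 0 := (h i).1 _ le_rfl

variable (b)

/-- The orthonormal frame with coordinates `t`. -/
noncomputable def echelonFrame {n : ℕ} (s : Fin n → Fin p) (t : Fin n → F) (i : Fin n) : F :=
  reflectionProd (fun j => b (s j) + t j) (b (s i))

variable {b}

theorem inner_add_basis_eq_zero {n : ℕ} {s : Fin n → Fin p} {t : Fin n → F} (hs : StrictMono s)
    (h : IsEchelon b s t) {i j : Fin n} (hij : j < i) :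
    inner ℝ (b (s i) + t i) (b (s j)) = 0 := by
  rw [inner_add_left, b.orthonormal.2 (hs hij).ne', real_inner_comm, (h i).2 j hij, add_zero]

/-- The last reflection fixes the earlier basis vectors `b (s i)`, so dropping the last row leaves
the earlier frame vectors unchanged. This drives the inductions on `n`. -/
theorem echelonFrame_castSucc {n : ℕ} {s : Fin (n + 1) → Fin p} {t : Fin (n + 1) → F}
    (hs : StrictMono s) (h : IsEchelon b s t) (i : Fin n) :
    echelonFrame b s t i.castSucc =
      echelonFrame b (fun i : Fin n => s i.castSucc) (fun i : Fin n => t i.castSucc) i := by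
  rw [echelonFrame, reflectionProd_succ, hyperplaneReflection_of_inner_eq_zero
    (inner_add_basis_eq_zero hs h (Fin.castSucc_lt_last i))]
  rfl

theorem echelonFrame_last {n : ℕ} (s : Fin (n + 1) → Fin p) (t : Fin (n + 1) → F) :
    echelonFrame b s t (Fin.last n) = reflectionProd (fun j : Fin n => b (s j.castSucc) +
      t j.castSucc) (hyperplaneReflection (b (s (Fin.last n)) + t (Fin.last n))
        (b (s (Fin.last n)))) := rfl

theorem strictMono_castSucc {n : ℕ} {s : Fin (n + 1) → Fin p} (hs : StrictMono s) :
    StrictMono fun i : Fin n => s i.castSucc :=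
  fun _ _ hij => hs (Fin.castSucc_lt_castSucc_iff.2 hij)

theorem orthonormal_echelonFrame {n : ℕ} {s : Fin n → Fin p} (hs : StrictMono s) (t : Fin n → F) :
    Orthonormal ℝ (echelonFrame b s t) :=
  (b.orthonormal.comp s hs.injective).comp_linearIsometryEquiv _

theorem add_mem_coordFiltration {n : ℕ} {s : Fin n → Fin p} {t : Fin n → F}
    (h : IsEchelon b s t) {m : ℕ} {i : Fin n} (hm : (s i : ℕ) < m) :
    b (s i) + t i ∈ coordFiltration b m :=
  Submodule.add_mem _ (basis_mem_coordFiltration b hm) (coordFiltration_mono b hm.le (h i).1)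

theorem echelonFrame_mem {n : ℕ} {s : Fin n → Fin p} {t : Fin n → F} (hs : StrictMono s)
    (h : IsEchelon b s t) (i : Fin n) : echelonFrame b s t i ∈ coordFiltration b (s i + 1) := by
  induction n with
  | zero => exact i.elim0
  | succ n ih =>
    cases i using Fin.lastCases with
    | cast i =>
      rw [echelonFrame_castSucc hs h]
      exact ih (strictMono_castSucc hs) h.castSucc i
    | last =>
      rw [echelonFrame, reflectionProd_mem_iff]
      · exact basis_mem_coordFiltration b (Nat.lt_succ_self _)
      · exact fun i => add_mem_coordFiltration h
          (Nat.lt_succ_of_le (Fin.le_def.1 (hs.monotone (Fin.le_last i))))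

/-- The reflections of smaller index move vectors only within `coordFiltration b (s i)`, where the
`s i`-th coordinate is zero. -/
theorem inner_echelonFrame {n : ℕ} {s : Fin n → Fin p} {t : Fin n → F} (hs : StrictMono s)
    (h : IsEchelon b s t) (i : Fin n) : inner ℝ (b (s i)) (echelonFrame b s t i) =
      inner ℝ (b (s i)) (hyperplaneReflection (b (s i) + t i) (b (s i))) := by
  induction n with
  | zero => exact i.elim0
  | succ n ih =>
    cases i using Fin.lastCases with
    | cast i =>
      rw [echelonFrame_castSucc hs h]
      exact ih (strictMono_castSucc hs) h.castSucc i
    | last =>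
      rw [echelonFrame_last, ← sub_eq_zero, ← inner_sub_right]
      exact reflectionProd_sub_mem (W := coordFiltration b (s (Fin.last n)))
        (fun j => add_mem_coordFiltration h (hs (Fin.castSucc_lt_last j))) _ _ le_rfl

theorem inner_echelonFrame_neg_iff {n : ℕ} {s : Fin n → Fin p} {t : Fin n → F} (hs : StrictMono s)
    (h : IsEchelon b s t) (i : Fin n) :
    inner ℝ (b (s i)) (echelonFrame b s t i) < 0 ↔ ‖t i‖ < 1 := by
  rw [inner_echelonFrame hs h,
    inner_hyperplaneReflection_unit_neg_iff (b.orthonormal.1 _) (h.inner_self i)]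

theorem echelonFrame_mem_of_norm_eq_one {n : ℕ} {s : Fin n → Fin p} {t : Fin n → F}
    (hs : StrictMono s) (h : IsEchelon b s t) {i : Fin n} (hi : ‖t i‖ = 1) :
    echelonFrame b s t i ∈ coordFiltration b (s i) := by
  refine mem_coordFiltration_of_succ b (echelonFrame_mem hs h i) ?_
  rw [inner_echelonFrame hs h, inner_hyperplaneReflection_unit (b.orthonormal.1 _) (h.inner_self i),
    hi]
  norm_num

theorem span_range_castSucc_sup {n : ℕ} (x : Fin (n + 1) → F) :
    Submodule.span ℝ (Set.range x) = Submodule.span ℝ (Set.range fun i : Fin n => x i.castSucc) ⊔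
      Submodule.span ℝ {x (Fin.last n)} := by
  rw [← Submodule.span_union]
  congr 1
  ext y
  simp only [Set.mem_range, Set.mem_union, Set.mem_singleton_iff, Fin.exists_fin_succ', eq_comm]

theorem span_sup_inf_eq_left {A V : Submodule ℝ F} {x : F} (hA : A ≤ V) (hx : x ∉ V) :
    (A ⊔ Submodule.span ℝ {x}) ⊓ V = A := by
  have : Submodule.span ℝ {x} ⊓ V = ⊥ := by
    refine (Submodule.eq_bot_iff _).2 fun y hy => ?_
    obtain ⟨c, rfl⟩ := Submodule.mem_span_singleton.1 hy.1
    by_contra h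
    exact hx ((V.smul_mem_iff fun hc => h (by rw [hc, zero_smul])).1 hy.2)
  rw [sup_inf_assoc_of_le _ hA, this, sup_bot_eq]

theorem span_echelonFrame_le {n : ℕ} {s : Fin n → Fin p} {t : Fin n → F} (hs : StrictMono s)
    (h : IsEchelon b s t) {m : ℕ} (hm : ∀ i, (s i : ℕ) < m) :
    Submodule.span ℝ (Set.range (echelonFrame b s t)) ≤ coordFiltration b m := by
  rw [Submodule.span_le]
  rintro _ ⟨i, rfl⟩
  exact coordFiltration_mono b (hm i) (echelonFrame_mem hs h i)

/-- A subspace of the open cell determines the coordinates of its frame. -/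
theorem echelonFrame_injective {n : ℕ} {s : Fin n → Fin p} {t t' : Fin n → F} (hs : StrictMono s)
    (h : IsEchelon b s t) (h' : IsEchelon b s t') (ht : ∀ i, ‖t i‖ < 1) (ht' : ∀ i, ‖t' i‖ < 1)
    (heq : Submodule.span ℝ (Set.range (echelonFrame b s t)) =
      Submodule.span ℝ (Set.range (echelonFrame b s t'))) : t = t' := by
  induction n with
  | zero => exact Subsingleton.elim _ _
  | succ n ih =>
    have hs' := strictMono_castSucc hs
    have hx : ∀ {t : Fin (n + 1) → F}, IsEchelon b s t → (∀ i, ‖t i‖ < 1) →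
        echelonFrame b s t (Fin.last n) ∉ coordFiltration b (s (Fin.last n)) :=
      fun h ht hmem => ((inner_echelonFrame_neg_iff hs h _).2 (ht _)).ne (hmem _ le_rfl)
    have heq0 := heq
    simp only [span_range_castSucc_sup, echelonFrame_castSucc hs h,
      echelonFrame_castSucc hs h'] at heq0
    have hle : ∀ {t : Fin (n + 1) → F}, IsEchelon b s t →
        Submodule.span ℝ (Set.range (echelonFrame b (fun i : Fin n => s i.castSucc)
          (fun i : Fin n => t i.castSucc))) ≤ coordFiltration b (s (Fin.last n)) :=
      fun h => span_echelonFrame_le hs' h.castSucc fun i => hs (Fin.castSucc_lt_last i)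
    -- Intersecting with this step of the flag cuts off the last frame vector, so the induction
    -- hypothesis applies.
    have hA := congrArg (· ⊓ coordFiltration b (s (Fin.last n))) heq0
    simp only [span_sup_inf_eq_left (hle h) (hx h ht),
      span_sup_inf_eq_left (hle h') (hx h' ht')] at hA
    have hcast := ih hs' h.castSucc h'.castSucc (fun i => ht _) (fun i => ht' _) hA
    have hmem : echelonFrame b s t' (Fin.last n) ∈
        Submodule.span ℝ (Set.range (echelonFrame b s t)) :=
      heq.ge (Submodule.subset_span ⟨_, rfl⟩)
    rw [span_range_castSucc_sup] at hmem
    obtain ⟨y, hy, z, hz, hyz⟩ := Submodule.mem_sup.1 hmem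
    obtain ⟨c, rfl⟩ := Submodule.mem_span_singleton.1 hz
    -- Both last vectors are orthogonal to the common span of the earlier ones, hence proportional.
    -- Unit length and the negative leading coordinate force the factor to be 1.
    have horth : ∀ {t : Fin (n + 1) → F}, echelonFrame b s t (Fin.last n) ∈
        (Submodule.span ℝ (Set.range fun i : Fin n => echelonFrame b s t i.castSucc))ᗮ := by
      intro t
      rw [Submodule.mem_orthogonal]
      intro w hw
      induction hw using Submodule.span_induction with
      | mem w hw =>
        obtain ⟨i, rfl⟩ := hw
        exact (orthonormal_echelonFrame hs t).2 (Fin.castSucc_lt_last i).ne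
      | zero => exact inner_zero_left _
      | add _ _ _ _ h1 h2 => rw [inner_add_left, h1, h2, add_zero]
      | smul a _ _ h1 => rw [inner_smul_left, h1, mul_zero]
    have hy0 : y = 0 := by
      refine inner_self_eq_zero (𝕜 := ℝ).1 ?_
      have h1 : inner ℝ y (echelonFrame b s t (Fin.last n)) = 0 :=
        (Submodule.mem_orthogonal _ _).1 horth y hy
      have h2 : inner ℝ y (echelonFrame b s t' (Fin.last n)) = 0 := by
        refine (Submodule.mem_orthogonal _ _).1 horth y ?_
        simp only [echelonFrame_castSucc hs h'] at hA ⊢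
        simp only [echelonFrame_castSucc hs h] at hy
        exact hA.le hy
      rw [← hyz, inner_add_right, inner_smul_right, h1, mul_zero, add_zero] at h2
      exact h2
    rw [hy0, zero_add] at hyz
    have hn := congrArg norm hyz
    rw [norm_smul, (orthonormal_echelonFrame hs t).1, (orthonormal_echelonFrame hs t').1, mul_one,
      Real.norm_eq_abs] at hn
    have hneg := (inner_echelonFrame_neg_iff hs h (Fin.last n)).2 (ht _)
    have hneg' := (inner_echelonFrame_neg_iff hs h' (Fin.last n)).2 (ht' _)
    rw [← hyz, inner_smul_right] at hneg'
    have hc : 0 < c := by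
      by_contra hc
      exact absurd hneg' (not_lt.2 (mul_nonneg_of_nonpos_of_nonpos (not_lt.1 hc) hneg.le))
    rw [abs_of_pos hc] at hn
    rw [hn, one_smul, echelonFrame_last, echelonFrame_last] at hyz
    have hcast' : ∀ i : Fin n, t i.castSucc = t' i.castSucc := fun i => congrFun hcast i
    simp only [hcast'] at hyz
    have hlast := hyperplaneReflection_unit_injective (b.orthonormal.1 _) (h.inner_self _)
      (h'.inner_self _) ((reflectionProd _).injective hyz)
    funext i
    cases i using Fin.lastCases with
    | cast i => exact hcast' i
    | last => exact hlast

theorem exists_unit_neg {W : Submodule ℝ F} {e z : F} (hz : z ∈ W) (h : inner ℝ e z ≠ 0) :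
    ∃ y ∈ W, ‖y‖ = 1 ∧ inner ℝ e y < 0 := by
  have hz0 : ‖z‖ ≠ 0 := by
    rintro h0
    rw [norm_eq_zero] at h0
    simp [h0] at h
  have hpos : 0 < ‖z‖⁻¹ := inv_pos.2 (lt_of_le_of_ne (norm_nonneg _) hz0.symm)
  rcases lt_or_gt_of_ne h with h | h
  · refine ⟨‖z‖⁻¹ • z, W.smul_mem _ hz, ?_, ?_⟩
    · rw [norm_smul, norm_inv, norm_norm, inv_mul_cancel₀ hz0]
    · rw [inner_smul_right]
      exact mul_neg_of_pos_of_neg hpos h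
  · refine ⟨-(‖z‖⁻¹ • z), W.neg_mem (W.smul_mem _ hz), ?_, ?_⟩
    · rw [norm_neg, norm_smul, norm_inv, norm_norm, inv_mul_cancel₀ hz0]
    · rw [inner_neg_right, inner_smul_right]
      exact neg_neg_of_pos (mul_pos hpos h)

/-- A subspace with jumps at `s` contains a frame with coordinates of norm less than one. -/
theorem exists_echelonFrame_mem {n : ℕ} {s : Fin n → Fin p} (hs : StrictMono s) (l : Submodule ℝ F)
    (hl : ∀ i, s i ∈ jumps b l) :
    ∃ t, IsEchelon b s t ∧ (∀ i, ‖t i‖ < 1) ∧ ∀ i, echelonFrame b s t i ∈ l := by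
  induction n with
  | zero => exact ⟨fun i => i.elim0, fun i => i.elim0, fun i => i.elim0, fun i => i.elim0⟩
  | succ n ih =>
    have hs' := strictMono_castSucc hs
    obtain ⟨t, ht, htn, htl⟩ := ih hs' fun i => hl _
    obtain ⟨x, hxl, hx, hx0⟩ := hl (Fin.last n)
    have hlt : ∀ i : Fin n, (s i.castSucc : ℕ) < s (Fin.last n) :=
      fun i => hs (Fin.castSucc_lt_last i)
    set R : F ≃ₗᵢ[ℝ] F := reflectionProd fun j : Fin n => b (s j.castSucc) + t j
    have hu : ∀ m, (s (Fin.last n) : ℕ) ≤ m → ∀ i : Fin n,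
        b (s i.castSucc) + t i ∈ coordFiltration b m :=
      fun m hm i => add_mem_coordFiltration ht ((hlt i).trans_le hm)
    -- Undoing the earlier reflections keeps the jump at the last index and turns the earlier frame
    -- vectors into basis vectors.
    obtain ⟨z0, rfl⟩ := R.surjective x
    have hz0 : z0 ∈ coordFiltration b (s (Fin.last n) + 1) :=
      (reflectionProd_mem_iff (hu _ (Nat.le_succ _))).1 hx
    have hz0' : inner ℝ (b (s (Fin.last n))) z0 ≠ 0 := by
      have : inner ℝ (b (s (Fin.last n))) (R z0 - z0) = 0 :=
        reflectionProd_sub_mem (hu _ le_rfl) z0 _ le_rfl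
      rw [inner_sub_right, sub_eq_zero] at this
      rwa [← this]
    have hne : ∀ i : Fin n, inner ℝ (b (s (Fin.last n))) (b (s i.castSucc)) = 0 :=
      fun i => b.orthonormal.2 (hs (Fin.castSucc_lt_last i)).ne'
    let W : Submodule ℝ F := (l.comap R.toLinearEquiv.toLinearMap ⊓
      coordFiltration b (s (Fin.last n) + 1)) ⊓
      (Submodule.span ℝ (Set.range fun i : Fin n => b (s i.castSucc)))ᗮ
    -- Removing the components along the earlier `b (s i)` stays in the pulled-back plane, since `R`
    -- sends these vectors to frame vectors in `l`.
    have hWz : z0 - ∑ i : Fin n, inner ℝ (b (s i.castSucc)) z0 • b (s i.castSucc) ∈ W := by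
      refine ⟨⟨?_, ?_⟩, ?_⟩
      · change R (z0 - _) ∈ l
        rw [map_sub, map_sum]
        refine l.sub_mem hxl (l.sum_mem fun i _ => ?_)
        rw [map_smul]
        exact l.smul_mem _ (htl i)
      · exact Submodule.sub_mem _ hz0 (Submodule.sum_mem _ fun i _ => Submodule.smul_mem _ _
          (basis_mem_coordFiltration b ((hlt i).trans (Nat.lt_succ_self _))))
      · refine (Submodule.mem_orthogonal _ _).2 ?_
        intro w hw
        induction hw using Submodule.span_induction with
        | mem w hw =>
          obtain ⟨i, rfl⟩ := hw
          have := (b.orthonormal.comp _ hs'.injective).inner_right_fintype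
            (fun i : Fin n => inner ℝ (b (s i.castSucc)) z0) i
          simp only [Function.comp_apply] at this
          rw [inner_sub_right, this, sub_self]
        | zero => exact inner_zero_left _
        | add _ _ _ _ h1 h2 => rw [inner_add_left, h1, h2, add_zero]
        | smul a _ _ h1 => rw [inner_smul_left, h1, mul_zero]
    have hWz' : inner ℝ (b (s (Fin.last n)))
        (z0 - ∑ i : Fin n, inner ℝ (b (s i.castSucc)) z0 • b (s i.castSucc)) ≠ 0 := by
      rw [inner_sub_right, inner_sum, Finset.sum_eq_zero, sub_zero]
      · exact hz0'
      · intro i _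
        rw [inner_smul_right, hne, mul_zero]
    obtain ⟨y, ⟨⟨hyl, hyV⟩, hyo⟩, hy1, hyneg⟩ := exists_unit_neg hWz hWz'
    obtain ⟨τ, hτe, hτ1, hτy, c, d, hcd⟩ :=
      exists_hyperplaneReflection_unit_eq (b.orthonormal.1 (s (Fin.last n))) hy1 hyneg
    have hech : IsEchelon b s (Fin.snoc t τ : Fin (n + 1) → F) := by
      intro i
      cases i using Fin.lastCases with
      | cast i =>
        rw [Fin.snoc_castSucc]
        refine ⟨(ht i).1, fun j hj => ?_⟩
        have hjn : (j : ℕ) < n := lt_trans (Fin.lt_def.1 hj) i.2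
        exact (ht i).2 ⟨j, hjn⟩ hj
      | last =>
        rw [Fin.snoc_last]
        refine ⟨mem_coordFiltration_of_succ b ?_ hτe, fun j hj => ?_⟩
        · rw [hcd]
          exact Submodule.add_mem _ (Submodule.smul_mem _ _ (basis_mem_coordFiltration b
            (Nat.lt_succ_self _))) (Submodule.smul_mem _ _ hyV)
        · have h1 : inner ℝ (b (s j)) y = 0 :=
            (Submodule.mem_orthogonal _ _).1 hyo _ (Submodule.subset_span ⟨⟨j, hj⟩, rfl⟩)
          rw [hcd, inner_add_right, inner_smul_right, inner_smul_right, h1,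
            b.orthonormal.2 (hs hj).ne]
          simp
    refine ⟨Fin.snoc t τ, hech, fun i => ?_, fun i => ?_⟩
    · cases i using Fin.lastCases with
      | cast i => simpa using htn i
      | last => simpa using hτ1
    · cases i using Fin.lastCases with
      | cast i =>
        rw [echelonFrame_castSucc hs hech]
        simpa using htl i
      | last =>
        rw [echelonFrame_last]
        simp only [Fin.snoc_last, Fin.snoc_castSucc, hτy]
        exact hyl

end EchelonFrame

/-! ### The Grassmannian is Hausdorff. -/

open InnerProductSpace

section GramSchmidt

variable {F : Type*} [NormedAddCommGroup F] [InnerProductSpace ℝ F] {n : ℕ}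

theorem continuous_gramSchmidt (k : Fin n) : Continuous
    fun v : {v : Fin n → F // LinearIndependent ℝ v} => gramSchmidt ℝ v.1 k := by
  induction k using WellFoundedLT.induction with
  | ind k ih =>
    have hv : Continuous fun v : {v : Fin n → F // LinearIndependent ℝ v} => v.1 k :=
      (continuous_apply k).comp continuous_subtype_val
    simp only [gramSchmidt_def ℝ _ k, Submodule.starProjection_singleton, RCLike.ofReal_real_eq_id,
      id]
    refine hv.sub (continuous_finsetSum _ fun i hi => ?_)
    have hi := ih i (Finset.mem_Iio.1 hi)
    refine Continuous.smul (((hi.inner hv)).div (hi.norm.pow 2) fun v => ?_) hi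
    simpa using gramSchmidt_ne_zero i v.2

theorem continuous_gramSchmidtNormed (k : Fin n) : Continuous
    fun v : {v : Fin n → F // LinearIndependent ℝ v} => gramSchmidtNormed ℝ v.1 k := by
  have h := continuous_gramSchmidt (F := F) k
  refine Continuous.smul (h.norm.inv₀ fun v => ?_) h
  simpa using gramSchmidt_ne_zero k v.2

theorem starProjection_span_eq_sum [FiniteDimensional ℝ F] {v : Fin n → F} (hv : LinearIndependent ℝ v) (x : F) :
    (Submodule.span ℝ (Set.range v)).starProjection x =
      ∑ k, inner ℝ (gramSchmidtNormed ℝ v k) x • gramSchmidtNormed ℝ v k := by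
  have hspan := (span_gramSchmidtNormed_range (𝕜 := ℝ) v).trans (span_gramSchmidt ℝ v)
  refine Submodule.eq_starProjection_of_mem_orthogonal ?_ ?_
  · refine Submodule.sum_mem _ fun k _ => Submodule.smul_mem _ _ ?_
    rw [← hspan]
    exact Submodule.subset_span ⟨k, rfl⟩
  · rw [← hspan, Submodule.mem_orthogonal]
    intro w hw
    induction hw using Submodule.span_induction with
    | mem w hw =>
      obtain ⟨i, rfl⟩ := hw
      rw [inner_sub_right, (gramSchmidtNormed_orthonormal hv).inner_right_fintype, sub_self]
    | zero => exact inner_zero_left _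
    | add _ _ _ _ h1 h2 => rw [inner_add_left, h1, h2, add_zero]
    | smul a _ _ h1 => rw [inner_smul_left, h1, mul_zero]

end GramSchmidt

theorem continuous_toGrassmannian {n p : ℕ} :
    Continuous (Frame.toGrassmannian : Frame n p → Grassmannian n p) :=
  continuous_coinduced_rng

/-- A subspace is determined by its orthogonal projection, which Gram-Schmidt shows to depend
continuously on a frame. -/
instance (n p : ℕ) : T2Space (Grassmannian n p) := by
  have hc : Continuous fun (l : Grassmannian n p) (x : E p) => l.1.starProjection x := by
    refine continuous_coinduced_dom.2 (continuous_pi fun x => ?_)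
    have : ((fun l : Grassmannian n p => l.1.starProjection x) ∘ Frame.toGrassmannian) =
        fun v : Frame n p =>
          ∑ k, (inner ℝ (gramSchmidtNormed ℝ v.1 k) x : ℝ) • gramSchmidtNormed ℝ v.1 k :=
      funext fun v => starProjection_span_eq_sum v.2 x
    change Continuous ((fun l : Grassmannian n p => l.1.starProjection x) ∘ Frame.toGrassmannian)
    rw [this]
    refine continuous_finsetSum _ fun k _ => ?_
    have h := continuous_gramSchmidtNormed (F := E p) k
    exact (h.inner (𝕜 := ℝ) continuous_const).smul h
  refine T2Space.of_injective_continuous (f := fun (l : Grassmannian n p) (x : E p) =>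
    l.1.starProjection x) (fun l m h => Subtype.ext ?_) hc
  ext x
  rw [← Submodule.starProjection_eq_self_iff, ← Submodule.starProjection_eq_self_iff,
    show l.1.starProjection x = m.1.starProjection x from congrFun h x]

/-! ### Embeddings from compactness, and radial rescaling. -/

/-- A continuous map on a compact set that is injective on a subset `s`, and sends the points
outside `s` outside the image of `s`, embeds `s`. -/
theorem isEmbedding_domRestrict_of_isCompact {X Y : Type*} [TopologicalSpace X]
    [TopologicalSpace Y] [T2Space Y] {f : X → Y} {s K : Set X} (hK : IsCompact K) (hs : s ⊆ K)
    (hf : ContinuousOn f K) (hinj : Set.InjOn f s)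
    (hdisj : ∀ x ∈ K, f x ∈ f '' s → x ∈ s) :
    Topology.IsEmbedding (s.domRestrict f) := by
  refine ⟨⟨(TopologicalSpace.ext_isClosed fun C => ?_).symm⟩, hinj.injective⟩
  rw [isClosed_induced_iff]
  constructor
  · rintro ⟨D, hD, rfl⟩
    exact hD.preimage (continuousOn_iff_continuous_domRestrict.1 (hf.mono hs))
  · intro hC
    obtain ⟨D, hD, rfl⟩ := isClosed_induced_iff.1 hC
    -- The image is compact, hence closed; `hdisj` and injectivity ensure that it meets the image of
    -- `s` only in the image of `s ∩ D`.
    refine ⟨f '' (K ∩ D), ((hK.inter_right hD).image_of_continuousOn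
      (hf.mono Set.inter_subset_left)).isClosed, ?_⟩
    ext x
    constructor
    · rintro ⟨y, ⟨hyK, hyD⟩, hyx⟩
      have hys := hdisj y hyK (hyx ▸ ⟨x, x.2, rfl⟩)
      have : y = x := hinj hys x.2 hyx
      rwa [Set.mem_preimage, ← this]
    · intro hx
      exact ⟨x, ⟨hs x.2, hx⟩, rfl⟩

/-- The radial homeomorphism from the unit ball of a Euclidean space onto the unit ball of the norm
induced by an injective linear map. -/
theorem exists_radial_rescaling {F G : Type*} [NormedAddCommGroup F] [InnerProductSpace ℝ F]
    [FiniteDimensional ℝ F] [NormedAddCommGroup G] [NormedSpace ℝ G] (T : F →ₗ[ℝ] G)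
    (hT : Function.Injective T) :
    ∃ h : F ≃ₜ F, (∀ x, ‖T (h x)‖ = ‖x‖) ∧
      ∀ g : F →ₗ[ℝ] F, (∀ x, ‖g x‖ = ‖x‖) → (∀ x, ‖T (g x)‖ = ‖T x‖) → ∀ x, h (g x) = g (h x) := by
  let s : Set F := Metric.ball 0 1
  let t : Set F := T ⁻¹' Metric.ball 0 1
  have hTc : Continuous T := T.continuous_of_finiteDimensional
  have hs : Convex ℝ s := convex_ball _ _
  have ht : Convex ℝ t := (convex_ball _ _).linear_preimage T
  have hs0 : s ∈ nhds 0 := Metric.ball_mem_nhds _ one_pos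
  have ht0 : t ∈ nhds 0 := (Metric.isOpen_ball.preimage hTc).mem_nhds (by simp)
  have hsb : Bornology.IsVonNBounded ℝ s := NormedSpace.isVonNBounded_ball _ _ _
  have htb : Bornology.IsVonNBounded ℝ t := by
    obtain ⟨K, -, hK⟩ := T.exists_antilipschitzWith (LinearMap.ker_eq_bot.2 hT)
    exact (NormedSpace.isVonNBounded_iff ℝ).2 (hK.isBounded_preimage Metric.isBounded_ball)
  have hgs : ∀ x, gauge s x = ‖x‖ := fun x => gauge_unit_ball x
  have hgt : ∀ x, gauge t x = ‖T x‖ := fun x => by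
    rw [← gauge_unit_ball (T x)]
    simp only [gauge_def', t, Set.mem_preimage, map_smul]
  -- The map scales `x` by ‖x‖ / ‖T x‖, a factor invariant under every `g` preserving both norms.
  refine ⟨gaugeRescaleHomeomorph s t hs hs0 hsb ht ht0 htb, fun x => ?_, fun g h1 h2 x => ?_⟩
  · rw [← hgt, ← hgs]
    exact gauge_gaugeRescale s (absorbent_nhds_zero ht0) htb x
  · change gaugeRescale s t (g x) = g (gaugeRescale s t x)
    simp only [gaugeRescale_def, hgs, hgt, h1, h2, map_smul]

theorem le_apply_of_strictMono {n : ℕ} {f : Fin n → ℕ} (hf : StrictMono f) (i : Fin n) :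
    (i : ℕ) ≤ f i := by
  obtain ⟨m, hm⟩ := i
  induction m with
  | zero => exact Nat.zero_le _
  | succ m ih =>
    have h1 := ih (by omega)
    have h2 : f ⟨m, by omega⟩ < f ⟨m + 1, hm⟩ := hf (Fin.mk_lt_mk.2 (Nat.lt_succ_self m))
    simp only at h1 ⊢
    omega

/-! ### Combinatorics of Schubert symbols. -/

namespace SchubertSymbol

variable {n p : ℕ} (σ : SchubertSymbol n p)

/-- The entries of a Schubert symbol, counted from `0`. -/
def index (i : Fin n) : Fin p :=
  ⟨σ.seq i - 1, by have := σ.one_le i; have := σ.le i; omega⟩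

theorem index_add_one (i : Fin n) : (σ.index i : ℕ) + 1 = σ.seq i :=
  Nat.sub_add_cancel (σ.one_le i)

theorem index_strictMono : StrictMono σ.index := by
  intro i j hij
  have := σ.strictMono hij
  rw [← index_add_one, ← index_add_one] at this
  exact Fin.lt_def.2 (by omega)

theorem dim_eq_sum : σ.dim = ∑ i, ((σ.index i : ℕ) - i) := by
  refine Finset.sum_congr rfl fun i _ => ?_
  rw [← index_add_one]
  omega

/-- The Schubert symbol with given entries, counted from `0`. -/
def ofIndex (o : Fin n → Fin p) (ho : StrictMono o) : SchubertSymbol n p where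
  seq i := o i + 1
  strictMono _ _ hij := Nat.succ_lt_succ (ho hij)
  one_le _ := Nat.le_add_left _ _
  le i := (o i).2

theorem index_ofIndex (o : Fin n → Fin p) (ho : StrictMono o) (i : Fin n) :
    (ofIndex o ho).index i = o i := rfl

theorem mem_cell_iff {V : ℕ → Submodule ℝ (E p)} {b : OrthonormalBasis (Fin p) ℝ (E p)}
    (hV : ∀ i ≤ p, V i = coordFiltration b i) {l : Grassmannian n p} :
    l ∈ σ.cell V ↔ ∀ i, σ.index i ∈ jumps b l.1 := by
  refine forall_congr' fun i => ?_
  have h1 := σ.index_add_one i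
  have h2 := σ.le i
  rw [← finrank_inf_coordFiltration_succ_iff, hV _ h2, hV _ (by omega), ← h1, Nat.add_sub_cancel]

open Classical in
theorem range_index_eq_jumps {b : OrthonormalBasis (Fin p) ℝ (E p)} {l : Submodule ℝ (E p)}
    (hl : finrank ℝ l = n) (h : ∀ i, σ.index i ∈ jumps b l) :
    Set.range σ.index = jumps b l := by
  refine Set.eq_of_subset_of_ncard_le (Set.range_subset_iff.2 h) ?_
  rw [Set.ncard_eq_toFinset_card', card_jumps, hl, ← Set.image_univ,
    Set.ncard_image_of_injective _ σ.index_strictMono.injective]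
  simp

theorem dim_eq_of_mem_jumps {τ : SchubertSymbol n p} {b : OrthonormalBasis (Fin p) ℝ (E p)}
    {l : Submodule ℝ (E p)} (hl : finrank ℝ l = n) (h : ∀ i, σ.index i ∈ jumps b l)
    (h' : ∀ i, τ.index i ∈ jumps b l) : σ.dim = τ.dim := by
  have := (σ.index_strictMono.range_inj τ.index_strictMono).1
    ((σ.range_index_eq_jumps hl h).trans (τ.range_index_eq_jumps hl h').symm)
  rw [dim_eq_sum, dim_eq_sum, this]

/-- A subspace with a basis `x` such that `x i ∈ V_{σ_i}`, and `x k ∈ V_{σ_k - 1}` for some `k`,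
lies in a Schubert cell of lower dimension. -/
theorem exists_dim_lt {b : OrthonormalBasis (Fin p) ℝ (E p)} {l : Submodule ℝ (E p)}
    (hl : finrank ℝ l = n) {x : Fin n → E p} (hx : LinearIndependent ℝ x) (hxl : ∀ i, x i ∈ l)
    (hxσ : ∀ i, x i ∈ coordFiltration b (σ.index i + 1)) {k : Fin n}
    (hk : x k ∈ coordFiltration b (σ.index k)) :
    ∃ τ : SchubertSymbol n p, τ.dim < σ.dim ∧ ∀ i, τ.index i ∈ jumps b l := by
  classical
  let o := (jumps b l).toFinset.orderEmbOfFin ((card_jumps b l).trans hl)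
  have ho : ∀ i, o i ∈ jumps b l := fun i =>
    Set.mem_toFinset.1 (Finset.orderEmbOfFin_mem _ _ i)
  -- If `x 0, …, x i` lie in the `m`-th step, then `l` meets it in dimension at least `i + 1`, so
  -- the jump `o i`, counted from 0, is below `m`.
  have hlt : ∀ (i : Fin n) (m : ℕ), m ≤ p → (∀ j ≤ i, x j ∈ coordFiltration b m) →
      (o i : ℕ) < m := by
    intro i m hm hj
    by_contra hoi
    have h1 : i + 1 ≤ finrank ℝ (l ⊓ coordFiltration b m : Submodule ℝ (E p)) := by
      let y : Finset.Iic i → (l ⊓ coordFiltration b m : Submodule ℝ (E p)) :=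
        fun j => ⟨x j, hxl j, hj j (Finset.mem_Iic.1 j.2)⟩
      have hy : LinearIndependent ℝ y :=
        LinearIndependent.of_comp (Submodule.subtype _) (hx.comp _ Subtype.val_injective)
      have := hy.fintype_card_le_finrank
      rwa [Fintype.card_coe, Fin.card_Iic] at this
    rw [← card_jumps_lt b l m hm] at h1
    have h2 : (Finset.univ.filter fun j : Fin p => j ∈ jumps b l ∧ (j : ℕ) < m) ⊆
        (Finset.Iio i).image o := by
      intro j hj
      obtain ⟨hj, hjm⟩ := (Finset.mem_filter.1 hj).2
      have : j ∈ Set.range o := by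
        rw [Finset.range_orderEmbOfFin]
        simpa using hj
      obtain ⟨c, rfl⟩ := this
      refine Finset.mem_image_of_mem _ (Finset.mem_Iio.2 (o.lt_iff_lt.1 (Fin.lt_def.2 ?_)))
      omega
    have h3 := (Finset.card_le_card h2).trans Finset.card_image_le
    rw [Fin.card_Iio] at h3
    omega
  have hle : ∀ i, (o i : ℕ) ≤ σ.index i := fun i => Nat.lt_succ_iff.1 <|
    hlt i _ (σ.index i).2 fun j hj => coordFiltration_mono b
      (Nat.succ_le_succ (Fin.le_def.1 (σ.index_strictMono.monotone hj))) (hxσ j)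
  have hkk : (o k : ℕ) < σ.index k := hlt k _ (σ.index k).2.le fun j hj => by
    rcases hj.eq_or_lt with rfl | hj
    · exact hk
    · exact coordFiltration_mono b (Nat.succ_le_of_lt (Fin.lt_def.1 (σ.index_strictMono hj)))
        (hxσ j)
  refine ⟨ofIndex o o.strictMono, ?_, ho⟩
  rw [dim_eq_sum, dim_eq_sum]
  refine Finset.sum_lt_sum (fun i _ => Nat.sub_le_sub_right (hle i) _) ⟨k, Finset.mem_univ _, ?_⟩
  -- Without this bound the truncated subtraction could lose the strict inequality.
  have : (k : ℕ) ≤ o k := le_apply_of_strictMono (f := fun i => (o i : ℕ)) o.strictMono k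
  rw [index_ofIndex]
  omega

/-- The indices, counted from `0`, of the free entries of the `i`-th row of an echelon matrix. -/
def free (i : Fin n) : Finset (Fin p) :=
  Finset.univ.filter fun j => j < σ.index i ∧ ∀ k < i, j ≠ σ.index k

/-- A trivial `P` yields the dimension count, and membership in φ yields the twist count. -/
theorem card_free_filter (i : Fin n) (P : ℕ → Prop) [DecidablePred P] :
    ((σ.free i).filter fun j : Fin p => P (j + 1)).card =
      ((Finset.Icc 1 (σ.seq i) \ σ.initial i).filter P).card := by
  refine Finset.card_bij (fun j _ => (j : ℕ) + 1) ?_ ?_ ?_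
  · intro j hj
    simp only [free, Finset.mem_filter, Finset.mem_univ, true_and] at hj
    have h1 := σ.index_add_one i
    have h2 := Fin.lt_def.1 hj.1.1
    simp only [initial, Finset.mem_filter, Finset.mem_sdiff, Finset.mem_Icc, Finset.mem_image,
      Finset.mem_Iic, not_exists, not_and]
    refine ⟨⟨by omega, fun k hk hkj => ?_⟩, hj.2⟩
    have h3 := σ.index_add_one k
    rcases hk.eq_or_lt with rfl | hk
    · omega
    · exact hj.1.2 k hk (Fin.ext (by omega))
  · intro j _ j' _ h
    exact Fin.ext (Nat.succ_injective h)
  · intro m hm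
    simp only [initial, Finset.mem_filter, Finset.mem_sdiff, Finset.mem_Icc, Finset.mem_image,
      Finset.mem_Iic, not_exists, not_and] at hm
    have h1 := σ.index_add_one i
    have h2 := σ.le i
    have h3 := hm.1.2 i le_rfl
    have h4 : m - 1 + 1 = m := by omega
    refine ⟨⟨m - 1, by omega⟩, ?_, h4⟩
    simp only [free, Finset.mem_filter, Finset.mem_univ, true_and, h4]
    refine ⟨⟨Fin.lt_def.2 ?_, fun k hk hkm => ?_⟩, hm.2⟩
    · simp only
      omega
    · have h5 := congrArg Fin.val hkm
      have h6 := σ.index_add_one k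
      exact hm.1.2 k hk.le (by simp only at h5; omega)

theorem card_free (i : Fin n) : (σ.free i).card = σ.seq i - (i + 1) := by
  have h := σ.card_free_filter i fun _ => True
  rw [Finset.filter_true, Finset.filter_true] at h
  rw [h, Finset.card_sdiff_of_subset, Nat.card_Icc, Nat.add_sub_cancel, initial,
    Finset.card_image_of_injective _ σ.strictMono.injective, Fin.card_Iic]
  intro m hm
  obtain ⟨k, hk, rfl⟩ := Finset.mem_image.1 hm
  exact Finset.mem_Icc.2 ⟨σ.one_le k, σ.strictMono.monotone (Finset.mem_Iic.1 hk)⟩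

/-- The free entries of the echelon matrices of a Schubert symbol. -/
abbrev FreeEntry : Type := (i : Fin n) × {j : Fin p // j ∈ σ.free i}

theorem card_freeEntry : Fintype.card σ.FreeEntry = σ.dim := by
  rw [Fintype.card_sigma]
  exact Finset.sum_congr rfl fun i _ => by rw [Fintype.card_coe, card_free]

/-- A free entry is twisted if the generator of `ℤ/2` acts on it by `-1`. -/
def IsTwisted {q : ℕ} (φ : FlagSymbol p q) (x : σ.FreeEntry) : Prop :=
  ¬ ((x.2 : ℕ) + 1 ∈ φ.entries ↔ σ.seq x.1 ∈ φ.entries)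

open Classical in
theorem card_isTwisted {q : ℕ} (φ : FlagSymbol p q) :
    Fintype.card {x : σ.FreeEntry // σ.IsTwisted φ x} = σ.twists φ := by
  have h1 : Fintype.card {x : σ.FreeEntry // σ.IsTwisted φ x} =
      ∑ i, ((σ.free i).filter fun j : Fin p =>
        ¬ ((j : ℕ) + 1 ∈ φ.entries ↔ σ.seq i ∈ φ.entries)).card := by
    rw [Fintype.card_subtype, ← Finset.univ_sigma_univ, Finset.card_filter, Finset.sum_sigma]
    refine Finset.sum_congr rfl fun i _ => ?_
    rw [Finset.card_filter, ← Finset.sum_coe_sort (σ.free i)]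
    refine Finset.sum_congr rfl fun j _ => ?_
    unfold IsTwisted
    congr
  rw [h1, twists, Finset.sum_filter, Finset.sum_filter, ← Finset.sum_add_distrib]
  refine Finset.sum_congr rfl fun i _ => ?_
  rw [σ.card_free_filter i fun m => ¬ (m ∈ φ.entries ↔ σ.seq i ∈ φ.entries)]
  by_cases hi : σ.seq i ∈ φ.entries
  · rw [if_pos hi, if_neg (not_not.2 hi), add_zero]
    congr 1
    ext m
    simp only [hi, iff_true, Finset.mem_filter, Finset.mem_sdiff, Finset.mem_union, not_or]
    tauto
  · rw [if_neg hi, if_pos hi, zero_add]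
    congr 1
    ext m
    simp only [hi, iff_false, not_not, Finset.mem_filter, Finset.mem_sdiff, Finset.mem_inter]
    tauto

theorem twists_le_dim {q : ℕ} (φ : FlagSymbol p q) : σ.twists φ ≤ σ.dim := by
  classical
  rw [← card_isTwisted, ← card_freeEntry]
  exact Fintype.card_subtype_le _

/-- The generator negates the last coordinates of ℝ^{a,b}, so the twisted entries must be numbered
last. -/
theorem exists_equiv_freeEntry {q : ℕ} (φ : FlagSymbol p q) :
    ∃ e : Fin σ.dim ≃ σ.FreeEntry,
      ∀ k : Fin σ.dim, (k : ℕ) + σ.twists φ < σ.dim ↔ ¬ σ.IsTwisted φ (e k) := by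
  classical
  let P : Fin σ.dim → Prop := fun k => ¬ (k : ℕ) + σ.twists φ < σ.dim
  have hle := σ.twists_le_dim φ
  have hP' : Fintype.card {k // ¬ P k} = σ.dim - σ.twists φ := by
    have : ∀ k, ¬ P k ↔ k ∈ Finset.univ.filter fun k : Fin σ.dim =>
        (k : ℕ) < σ.dim - σ.twists φ := by
      intro k
      simp only [P, not_not, Finset.mem_filter, Finset.mem_univ, true_and]
      omega
    rw [Fintype.card_congr (Equiv.subtypeEquivRight this), Fintype.card_coe,
      Fin.card_filter_val_lt]
    omega
  have hP : Fintype.card {k // P k} = σ.twists φ := by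
    have := Fintype.card_subtype_compl P
    have h2 := Fintype.card_subtype_le P
    rw [hP', Fintype.card_fin] at this
    rw [Fintype.card_fin] at h2
    omega
  have h1 : Fintype.card {k // P k} = Fintype.card {x // σ.IsTwisted φ x} := by
    rw [hP, card_isTwisted]
  have h2 : Fintype.card {k // ¬ P k} = Fintype.card {x // ¬ σ.IsTwisted φ x} := by
    rw [hP', Fintype.card_subtype_compl, card_isTwisted, card_freeEntry]
  let e1 := Fintype.equivOfCardEq h1
  let e2 := Fintype.equivOfCardEq h2
  refine ⟨(Equiv.sumCompl P).symm.trans ((Equiv.sumCongr e1 e2).trans (Equiv.sumCompl _)), ?_⟩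
  intro k
  by_cases hk : P k
  · have h3 : σ.IsTwisted φ (e1 ⟨k, hk⟩) := (e1 ⟨k, hk⟩).2
    simp only [Equiv.trans_apply, Equiv.sumCompl_symm_apply_of_pos hk, Equiv.sumCongr_apply,
      Sum.map_inl, Equiv.sumCompl_apply_inl, h3, not_true, iff_false]
    exact hk
  · have h3 : ¬ σ.IsTwisted φ (e2 ⟨k, hk⟩) := (e2 ⟨k, hk⟩).2
    simp only [Equiv.trans_apply, Equiv.sumCompl_symm_apply_of_neg hk, Equiv.sumCongr_apply,
      Sum.map_inr, Equiv.sumCompl_apply_inr, h3, not_false_iff, iff_true]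
    exact not_not.1 hk

/-! ### Linear coordinates on echelon matrices. -/

section Coordinates

variable (b : OrthonormalBasis (Fin p) ℝ (E p)) {a : ℕ} (e : Fin a ≃ σ.FreeEntry)

/-- The rows of the echelon matrix with given free entries. -/
noncomputable def rows : E a →ₗ[ℝ] (Fin n → E p) where
  toFun x i := ∑ j : {j // j ∈ σ.free i}, x (e.symm ⟨i, j⟩) • b j
  map_add' x y := by
    funext i
    simp [add_smul, Finset.sum_add_distrib]
  map_smul' c x := by
    funext i
    simp [mul_smul, Finset.smul_sum]

theorem rows_apply (x : E a) (i : Fin n) :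
    σ.rows b e x i = ∑ j : {j // j ∈ σ.free i}, x (e.symm ⟨i, j⟩) • b j := rfl

theorem inner_rows (x : E a) (i : Fin n) (j : {j // j ∈ σ.free i}) :
    inner ℝ (b j) (σ.rows b e x i) = x (e.symm ⟨i, j⟩) :=
  (b.orthonormal.comp _ Subtype.val_injective).inner_right_fintype
    (fun j : {j // j ∈ σ.free i} => x (e.symm ⟨i, j⟩)) j

theorem inner_rows_of_notMem (x : E a) {i : Fin n} {j : Fin p} (hj : j ∉ σ.free i) :
    inner ℝ (b j) (σ.rows b e x i) = 0 := by
  rw [rows_apply, inner_sum]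
  refine Finset.sum_eq_zero fun c _ => ?_
  rw [inner_smul_right, b.orthonormal.2 (by rintro rfl; exact hj c.2), mul_zero]

theorem isEchelon_rows (x : E a) : IsEchelon b σ.index (σ.rows b e x) := by
  refine fun i => ⟨fun j hj => σ.inner_rows_of_notMem b e x fun h => ?_,
    fun k hk => σ.inner_rows_of_notMem b e x fun h => ?_⟩
  · exact absurd (Fin.lt_def.1 (Finset.mem_filter.1 h).2.1) (not_lt.2 hj)
  · exact (Finset.mem_filter.1 h).2.2 k hk rfl

theorem rows_injective : Function.Injective (σ.rows b e) := by
  intro x y h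
  ext k
  obtain ⟨⟨i, j⟩, rfl⟩ := e.symm.surjective k
  rw [← inner_rows, h, inner_rows]

theorem exists_rows_eq {t : Fin n → E p} (ht : IsEchelon b σ.index t) :
    ∃ x, σ.rows b e x = t := by
  refine ⟨WithLp.toLp 2 fun k => inner ℝ (b (e k).2) (t (e k).1), ?_⟩
  funext i
  rw [← b.sum_repr' (σ.rows b e _ i), ← b.sum_repr' (t i)]
  refine Finset.sum_congr rfl fun j _ => ?_
  congr 1
  by_cases hj : j ∈ σ.free i
  · rw [σ.inner_rows b e _ i ⟨j, hj⟩]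
    change (fun x : σ.FreeEntry => (inner ℝ (b x.2) (t x.1) : ℝ)) (e (e.symm ⟨i, ⟨j, hj⟩⟩)) = _
    rw [Equiv.apply_symm_apply]
  · rw [σ.inner_rows_of_notMem b e _ hj]
    simp only [free, Finset.mem_filter, Finset.mem_univ, true_and, not_and_or, not_lt, not_forall,
      not_not] at hj
    rcases hj with hj | ⟨k, hk, rfl⟩
    · exact ((ht i).1 j hj).symm
    · exact ((ht i).2 k hk).symm

end Coordinates

end SchubertSymbol

/-! ### Equivariance of the coordinates. -/

/-- The action of the generator as a linear isometry. -/
noncomputable def actIsometry (p q : ℕ) : E p →ₗᵢ[ℝ] E p where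
  toLinearMap := (act p q).toLinearMap
  norm_map' x := by
    rw [EuclideanSpace.norm_eq, EuclideanSpace.norm_eq]
    congr 1
    refine Finset.sum_congr rfl fun k _ => ?_
    change ‖sgn p q k * x k‖ ^ 2 = _
    rw [norm_mul, mul_pow, Real.norm_eq_abs, sq_abs, sq, sgn_mul_self, one_mul]

theorem actIsometry_apply (p q : ℕ) (x : E p) : actIsometry p q x = act p q x := rfl

/-- The sign by which the generator acts on the `j`-th basis vector (counted from `0`) of a basis
adapted to a flag. -/
def FlagSymbol.sign {p q : ℕ} (φ : FlagSymbol p q) (j : Fin p) : ℝ :=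
  if (j : ℕ) + 1 ∈ φ.entries then -1 else 1

theorem FlagSymbol.sign_mul_self {p q : ℕ} (φ : FlagSymbol p q) (j : Fin p) :
    φ.sign j * φ.sign j = 1 := by
  unfold sign
  split <;> norm_num

/-- The entry of row `i` at column `j` changes by the product of the signs of `σ.index i` and `j`,
which is -1 exactly when the entry is twisted. -/
theorem SchubertSymbol.rows_act {n p q : ℕ} (σ : SchubertSymbol n p) (φ : FlagSymbol p q)
    {b : OrthonormalBasis (Fin p) ℝ (E p)} (hb : ∀ j, act p q (b j) = φ.sign j • b j)
    {e : Fin σ.dim ≃ σ.FreeEntry}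
    (he : ∀ k : Fin σ.dim, (k : ℕ) + σ.twists φ < σ.dim ↔ ¬ σ.IsTwisted φ (e k)) (x : E σ.dim) (i : Fin n) :
    σ.rows b e (act σ.dim (σ.twists φ) x) i =
      φ.sign (σ.index i) • act p q (σ.rows b e x i) := by
  rw [rows_apply, rows_apply, map_sum, Finset.smul_sum]
  refine Finset.sum_congr rfl fun j _ => ?_
  rw [map_smul, hb, smul_smul, smul_smul]
  congr 1
  change sgn _ _ _ * _ = _
  rw [mul_right_comm]
  congr 1
  have h := he (e.symm ⟨i, j⟩)
  rw [Equiv.apply_symm_apply] at h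
  simp only [sgn, h, IsTwisted, not_not, FlagSymbol.sign, index_add_one]
  split_ifs <;> first | (exfalso; tauto) | norm_num

/-! ### The characteristic map and the representation cell. -/

section CharacteristicMap

variable {n p : ℕ} (b : OrthonormalBasis (Fin p) ℝ (E p)) (s : Fin n → Fin p)

/-- The subspace spanned by the frame with coordinates `t`. -/
noncomputable def echelonPlane (hs : StrictMono s) (t : Fin n → E p) : Grassmannian n p :=
  Frame.toGrassmannian ⟨echelonFrame b s t, (orthonormal_echelonFrame hs t).linearIndependent⟩

variable {b s}

theorem echelonFrame_mem_echelonPlane (hs : StrictMono s) (t : Fin n → E p) (i : Fin n) :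
    echelonFrame b s t i ∈ (echelonPlane b s hs t).1 :=
  Submodule.subset_span ⟨i, rfl⟩

theorem echelonPlane_eq (hs : StrictMono s) {t : Fin n → E p} {l : Grassmannian n p}
    (h : ∀ i, echelonFrame b s t i ∈ l.1) : echelonPlane b s hs t = l := by
  refine Subtype.ext (Submodule.eq_of_le_of_finrank_eq (Submodule.span_le.2 ?_)
    ((echelonPlane b s hs t).2.trans l.2.symm))
  rintro _ ⟨i, rfl⟩
  exact h i

theorem continuous_echelonPlane (hs : StrictMono s) {X : Type*} [TopologicalSpace X]
    {t : X → Fin n → E p} (ht : Continuous t) (h : ∀ x, IsEchelon b s (t x)) :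
    Continuous fun x => echelonPlane b s hs (t x) := by
  refine continuous_toGrassmannian.comp (Continuous.subtype_mk (continuous_pi fun i => ?_) _)
  refine continuous_reflectionProd (by fun_prop) (fun x i h0 => ?_) continuous_const
  have := norm_add_sq_of_unit (b.orthonormal.1 (s i)) ((h x).inner_self i)
  rw [h0, norm_zero] at this
  nlinarith [sq_nonneg ‖t x i‖]

theorem echelonPlane_act (hs : StrictMono s) {q : ℕ} {c : Fin p → ℝ} (hc : ∀ j, c j * c j = 1)
    (hb : ∀ j, act p q (b j) = c j • b j) {t t' : Fin n → E p}
    (ht : ∀ i, t' i = c (s i) • act p q (t i)) :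
    echelonPlane b s hs t' = (echelonPlane b s hs t).act q := by
  -- This absorbs the sign of `b (s i)`, so that `b (s i) + t' i` is a sign times the image of `b (s
  -- i) + t i`.
  have hb' : ∀ j, b j = c j • act p q (b j) := fun j => by rw [hb, smul_smul, hc, one_smul]
  have hu : (fun i => b (s i) + t' i) =
      fun i => c (s i) • actIsometry p q (b (s i) + t i) := by
    funext i
    rw [map_add, smul_add, actIsometry_apply, actIsometry_apply, ← hb', ht]
  refine echelonPlane_eq hs fun i => ?_
  have : echelonFrame b s t' i = c (s i) • act p q (echelonFrame b s t i) := by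
    rw [echelonFrame, hu, hb' (s i), map_smul, ← actIsometry_apply, reflectionProd_map _ fun i => hc _]
    rfl
  rw [this]
  exact Submodule.smul_mem _ _ ⟨_, echelonFrame_mem_echelonPlane hs t i, rfl⟩

end CharacteristicMap

/-- The Schubert cell of `σ` is a representation cell; its characteristic map is the composite of a
radial rescaling of the disk with the map that sends an echelon matrix to the plane spanned by its
frame. -/
theorem SchubertSymbol.isRepCell_cell {n p q : ℕ} (σ : SchubertSymbol n p) (φ : FlagSymbol p q)
    {V : ℕ → Submodule ℝ (E p)} (hV : IsFlag φ V) :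
    IsRepCell (Grassmannian.act (n := n) q) (skeletonBelow n V σ.dim) (σ.cell V) σ.dim
      (σ.twists φ) := by
  obtain ⟨b, hVb, hb⟩ := hV.exists_orthonormalBasis
  obtain ⟨e, he⟩ := σ.exists_equiv_freeEntry φ
  have hs := σ.index_strictMono
  have hb : ∀ j, act p q (b j) = φ.sign j • b j := hb
  have hact := σ.rows_act φ hb he
  have hT : Continuous (σ.rows b e) := (σ.rows b e).continuous_of_finiteDimensional
  have hech := σ.isEchelon_rows b e
  obtain ⟨h, hnorm, hequiv⟩ := exists_radial_rescaling (σ.rows b e) (σ.rows_injective b e)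
  have hcomm : ∀ x, h (act _ (σ.twists φ) x) = act _ (σ.twists φ) (h x) := by
    refine hequiv (act _ (σ.twists φ)).toLinearMap (actIsometry _ _).norm_map fun x => ?_
    have : ∀ i, ‖σ.rows b e (act _ (σ.twists φ) x) i‖ = ‖σ.rows b e x i‖ := by
      intro i
      have hsign : ‖φ.sign (σ.index i)‖ = 1 := by
        unfold FlagSymbol.sign
        split <;> norm_num
      rw [hact, norm_smul, hsign, one_mul]
      exact (actIsometry p q).norm_map _
    -- The norm on tuples of rows is the maximum of the row norms; its unit ball is the product of
    -- the unit balls of the rows.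
    change ‖σ.rows b e (act _ (σ.twists φ) x)‖ = _
    simp only [Pi.norm_def, nnnorm, this]
  let Φ : E σ.dim → Grassmannian n p := fun x => echelonPlane b σ.index hs (σ.rows b e (h x))
  have hball : ∀ x ∈ Metric.ball (0 : E σ.dim) 1, ∀ i, ‖σ.rows b e (h x) i‖ < 1 := by
    intro x hx
    rw [mem_ball_zero_iff, ← hnorm] at hx
    exact (pi_norm_lt_iff one_pos).1 hx
  have hcont : Continuous Φ :=
    continuous_echelonPlane hs (hT.comp h.continuous) fun x => hech _
  have himage : Φ '' Metric.ball 0 1 = σ.cell V := by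
    ext l
    constructor
    · rintro ⟨x, hx, rfl⟩
      refine (σ.mem_cell_iff hVb).2 fun i => ⟨_, echelonFrame_mem_echelonPlane hs _ i,
        echelonFrame_mem hs (hech _) i, ?_⟩
      exact ((inner_echelonFrame_neg_iff hs (hech _) i).2 (hball x hx i)).ne
    · intro hl
      obtain ⟨t, ht, ht1, htl⟩ := exists_echelonFrame_mem hs l.1 ((σ.mem_cell_iff hVb).1 hl)
      obtain ⟨x, rfl⟩ := σ.exists_rows_eq b e ht
      refine ⟨h.symm x, ?_, ?_⟩
      · rw [mem_ball_zero_iff, ← hnorm, h.apply_symm_apply]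
        exact (pi_norm_lt_iff one_pos).2 ht1
      · simp only [Φ, h.apply_symm_apply]
        exact echelonPlane_eq hs htl
  have hsphere : Set.MapsTo Φ (Metric.sphere 0 1) (skeletonBelow n V σ.dim) := by
    intro x hx
    rw [mem_sphere_zero_iff_norm, ← hnorm] at hx
    have hle : ∀ i, ‖σ.rows b e (h x) i‖ ≤ 1 := fun i => (norm_le_pi_norm _ i).trans hx.le
    obtain ⟨k, hk⟩ : ∃ k, ‖σ.rows b e (h x) k‖ = 1 := by
      by_contra! hne
      exact hx.not_lt ((pi_norm_lt_iff one_pos).2 fun i => lt_of_le_of_ne (hle i) (hne i))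
    obtain ⟨τ, hτ, hτl⟩ := σ.exists_dim_lt (Φ x).2
      (orthonormal_echelonFrame hs _).linearIndependent (echelonFrame_mem_echelonPlane hs _)
      (echelonFrame_mem hs (hech _)) (echelonFrame_mem_of_norm_eq_one hs (hech _) hk)
    exact ⟨τ, hτ, (τ.mem_cell_iff hVb).2 hτl⟩
  refine ⟨σ.twists_le_dim φ, Φ, hcont.continuousOn, fun x _ => ?_, ?_, himage, hsphere⟩
  · simp only [Φ, hcomm]
    exact echelonPlane_act hs φ.sign_mul_self hb (hact _)
  · refine isEmbedding_domRestrict_of_isCompact (isCompact_closedBall 0 1)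
      Metric.ball_subset_closedBall hcont.continuousOn ?_ ?_
    · intro x hx y hy hxy
      exact h.injective (σ.rows_injective b e (echelonFrame_injective hs (hech _) (hech _)
        (hball x hx) (hball y hy) (congrArg Subtype.val hxy)))
    · intro x hx hxe
      by_contra hxb
      have hx1 : x ∈ Metric.sphere (0 : E σ.dim) 1 := by
        rw [← Metric.closedBall_sdiff_ball]
        exact ⟨hx, hxb⟩
      obtain ⟨τ, hτ, hτl⟩ := hsphere hx1
      rw [himage] at hxe
      -- A boundary point lands in a cell of smaller dimension, and a plane cannot lie in cells of
      -- two different dimensions.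
      exact hτ.ne (τ.dim_eq_of_mem_jumps (Φ x).2 ((τ.mem_cell_iff hVb).1 hτl)
        ((σ.mem_cell_iff hVb).1 hxe))

end RepGrassmann

theorem mainTheorem12 {n p q : ℕ} (σ : RepGrassmann.SchubertSymbol n p)
    (φ : RepGrassmann.FlagSymbol p q) (V : ℕ → Submodule ℝ (RepGrassmann.E p))
    (hV : RepGrassmann.IsFlag φ V) :
    RepGrassmann.IsRepCell (RepGrassmann.Grassmannian.act (n := n) q)
      (RepGrassmann.skeletonBelow n V σ.dim) (σ.cell V) σ.dim (σ.twists φ) :=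
  σ.isRepCell_cell φ hV
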